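/- Let $\mathbb N=\{0,1,2,\ldots\}$. (i) For every integer $n>1$ there are $x,y,z,w\in\mathbb N$ and a prime $p$ such that $$n=x^2+y^2+z^2+2w^2\quad\text{and}\quad x+y=p.$$ (ii) For every integer $n>2$ there are $x,y,z,w\in\mathbb N$ such that $$n=x^2+y^2+z^2+2w^2\quad\text{and}\quad x+w\ \text{is prime}.$$ -/

import Mathlib

/-! Fix a prime `p` first. With `x, y = (p ± u)/2` one has `x² + y² = (p² + u²)/2`, so (i) asks for
`2n - p² = u² + 2z² + 4w²`. With `w = (p + v)/3` and `x = p - w` one has `x² + 2w² = (2p² + v²)/3`,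
so (ii) asks for `3n - 2p² = v² + 3y² + 3z²`. Nonnegativity follows from `n ≤ p²`.

Both ternary representations come from reduction theory: Dirichlet's theorem and reciprocity build a
form of half-discriminant 2 or 3 with the desired value, and `exists_reduced_one` leaves only forms
that can be identified by hand.

A prime with `n ≤ p² ≤ 3n/2` exists because `(11/9)² < 3/2` and Chebyshev's method gives primes in
`(N, 11N/9]`; smaller cases are computed. -/

/-! ### Reduction of positive definite ternary forms -/

/-- The ternary form `a x² + b y² + c z² + r x y + s x z + t y z` is positive definite of
half-discriminant `d` and represents `n`. -/
def TernaryRep (d n a b c r s t : ℤ) : Prop :=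
  0 < a ∧ 0 < 4 * a * b - r ^ 2 ∧
    4 * a * b * c + r * s * t - a * t ^ 2 - b * s ^ 2 - c * r ^ 2 = d ∧
    ∃ x y z : ℤ, n = a * x ^ 2 + b * y ^ 2 + c * z ^ 2 + r * x * y + s * x * z + t * y * z

namespace TernaryRep

variable {d n a b c r s t : ℤ}

lemma pos_b (h : TernaryRep d n a b c r s t) : 0 < b := by
  obtain ⟨ha, hA, -⟩ := h
  by_contra hb
  nlinarith [sq_nonneg r, mul_nonneg ha.le (not_lt.1 hb |> neg_nonneg.2)]

/-- Completing the square, `4a·f = (2ax + ry + sz)² + Ay² + 2Byz + Cz²` with `A = 4ab - r²`, `B =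
2at - rs`, `C = 4ac - s²`; this is `AC - B²`. -/
lemma minors (h : TernaryRep d n a b c r s t) :
    (4 * a * b - r ^ 2) * (4 * a * c - s ^ 2) - (2 * a * t - r * s) ^ 2 = 4 * a * d := by
  obtain ⟨-, -, hd, -⟩ := h
  rw [← hd]; ring

lemma pos_minor (hd : 0 < d) (h : TernaryRep d n a b c r s t) : 0 < 4 * a * c - s ^ 2 := by
  have h1 := h.minors
  obtain ⟨ha, hA, -⟩ := h
  have : 0 < (4 * a * b - r ^ 2) * (4 * a * c - s ^ 2) := by nlinarith [mul_pos ha hd]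
  exact pos_of_mul_pos_right this hA.le

lemma shift_xy (k : ℤ) (h : TernaryRep d n a b c r s t) :
    TernaryRep d n a (a * k ^ 2 + b + r * k) c (r + 2 * a * k) s (t + s * k) := by
  obtain ⟨ha, hA, hd, x, y, z, hn⟩ := h
  refine ⟨ha, ?_, ?_, x - k * y, y, z, ?_⟩
  · convert hA using 1; ring
  · rw [← hd]; ring
  · rw [hn]; ring

lemma shift_xz (k : ℤ) (h : TernaryRep d n a b c r s t) :
    TernaryRep d n a b (a * k ^ 2 + c + s * k) r (s + 2 * a * k) (t + r * k) := by
  obtain ⟨ha, hA, hd, x, y, z, hn⟩ := h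
  refine ⟨ha, hA, ?_, x - k * z, y, z, ?_⟩
  · rw [← hd]; ring
  · rw [hn]; ring

lemma shift_yz (k : ℤ) (h : TernaryRep d n a b c r s t) :
    TernaryRep d n a b (b * k ^ 2 + c + t * k) r (s + r * k) (t + 2 * b * k) := by
  obtain ⟨ha, hA, hd, x, y, z, hn⟩ := h
  refine ⟨ha, hA, ?_, x, y - k * z, z, ?_⟩
  · rw [← hd]; ring
  · rw [hn]; ring

lemma swap_yz (hd : 0 < d) (h : TernaryRep d n a b c r s t) : TernaryRep d n a c b s r t := by
  have hC := h.pos_minor hd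
  obtain ⟨ha, hA, hd, x, y, z, hn⟩ := h
  refine ⟨ha, hC, ?_, x, z, y, ?_⟩
  · rw [← hd]; ring
  · rw [hn]; ring

lemma swap_xy (h : TernaryRep d n a b c r s t) : TernaryRep d n b a c r t s := by
  have hb := h.pos_b
  obtain ⟨ha, hA, hd, x, y, z, hn⟩ := h
  refine ⟨hb, ?_, ?_, y, x, z, ?_⟩
  · convert hA using 1; ring
  · rw [← hd]; ring
  · rw [hn]; ring

end TernaryRep

lemma Int.exists_abs_two_mul_add_mul_le (B : ℤ) {m : ℤ} (hm : 0 < m) :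
    ∃ k : ℤ, |2 * (B + m * k)| ≤ m := by
  refine ⟨-((2 * B + m) / (2 * m)), abs_le.2 ?_⟩
  have h1 := Int.emod_add_mul_ediv (2 * B + m) (2 * m)
  have h2 := Int.emod_nonneg (2 * B + m) (by lia : 2 * m ≠ 0)
  have h3 := Int.emod_lt_of_pos (2 * B + m) (by lia : 0 < 2 * m)
  constructor <;> nlinarith

namespace TernaryRep

/-- Reduction of positive definite ternary quadratic forms. -/
theorem exists_reduced {d n a b c r s t : ℤ} (hd : 0 < d) (h : TernaryRep d n a b c r s t) :
    ∃ a b c r s t : ℤ, TernaryRep d n a b c r s t ∧ |r| ≤ a ∧ |s| ≤ a ∧ a ≤ b ∧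
      |2 * (2 * a * t - r * s)| ≤ 4 * a * b - r ^ 2 ∧
      4 * a * b - r ^ 2 ≤ 4 * a * c - s ^ 2 := by
  -- Lexicographic descent on `(a, A)`: swapping `y, z` replaces `A` by `C` and keeps `a`; swapping
  -- `x, y` replaces `a` by `b`.
  obtain ⟨K, hK⟩ : ∃ K : ℕ, a.toNat = K := ⟨_, rfl⟩
  induction K using Nat.strong_induction_on generalizing a b c r s t with
  | _ K ihK =>
  obtain ⟨M, hM⟩ : ∃ M : ℕ, (4 * a * b - r ^ 2).toNat = M := ⟨_, rfl⟩
  induction M using Nat.strong_induction_on generalizing a b c r s t with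
  | _ M ihM =>
  have ha := h.1
  -- The `yz` shift reduces `B` modulo `A`; the later shifts of `x` reduce `r` and `s` modulo `2a`
  -- without changing `A, B, C`.
  obtain ⟨k, hk⟩ := Int.exists_abs_two_mul_add_mul_le (2 * a * t - r * s) h.2.1
  have h1 := h.shift_yz k
  set c1 := b * k ^ 2 + c + t * k
  set s1 := s + r * k with hs1
  set t1 := t + 2 * b * k with ht1
  obtain ⟨l, hl⟩ := Int.exists_abs_two_mul_add_mul_le r (by lia : 0 < 2 * a)
  have h2 := h1.shift_xy l
  set b2 := a * l ^ 2 + b + r * l with hb2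
  set r2 := r + 2 * a * l with hr2
  set t2 := t1 + s1 * l with ht2
  obtain ⟨m, hm⟩ := Int.exists_abs_two_mul_add_mul_le s1 (by lia : 0 < 2 * a)
  have h3 := h2.shift_xz m
  set c3 := a * m ^ 2 + c1 + s1 * m
  set s3 := s1 + 2 * a * m with hs3
  set t3 := t2 + r2 * m with ht3
  have hA : 4 * a * b2 - r2 ^ 2 = 4 * a * b - r ^ 2 := by rw [hb2, hr2]; ring
  have hB : 2 * a * t3 - r2 * s3 =
      2 * a * t - r * s + (4 * a * b - r ^ 2) * k := by
    rw [ht3, hs3, ht2, hr2, ht1, hs1]; ring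
  have hA0 := h.2.1
  have hr : |r2| ≤ a := by rw [abs_mul, abs_two] at hl; lia
  have hs : |s3| ≤ a := by rw [abs_mul, abs_two] at hm; lia
  by_cases hab : a ≤ b2
  · by_cases hAC : 4 * a * b2 - r2 ^ 2 ≤ 4 * a * c3 - s3 ^ 2
    · exact ⟨a, b2, c3, r2, s3, t3, h3, hr, hs, hab, by rw [hA, hB]; exact hk, hAC⟩
    · have hC := h3.pos_minor hd
      exact ihM _ (by lia) (h3.swap_yz hd) hK rfl
  · have := h3.pos_b
    exact ihK _ (by lia) h3.swap_xy rfl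

/-- Reducedness gives `3a² ≤ A`, and `AC - B² = 4ad` gives `3A² ≤ 16ad`. Hence `27a³ ≤ 16d ≤ 48`,
which forces `a = 1`, then `A ≤ 4` and `b = 1`. -/
theorem exists_reduced_one {d n a b c r s t : ℤ} (hd : 0 < d) (hd3 : d ≤ 3)
    (h : TernaryRep d n a b c r s t) :
    ∃ c r s t : ℤ, TernaryRep d n 1 1 c r s t ∧ |r| ≤ 1 ∧ |s| ≤ 1 ∧
      |2 * (2 * t - r * s)| ≤ 4 - r ^ 2 ∧ 4 - r ^ 2 ≤ 4 * c - s ^ 2 ∧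
      (4 - r ^ 2) * (4 * c - s ^ 2) - (2 * t - r * s) ^ 2 = 4 * d := by
  obtain ⟨a, b, c, r, s, t, h, hr, hs, hab, hB, hAC⟩ := exists_reduced hd h
  have hm := h.minors
  have ha := h.1
  set A := 4 * a * b - r ^ 2 with hA
  set C := 4 * a * c - s ^ 2
  set B := 2 * a * t - r * s
  have hr2 : r ^ 2 ≤ a ^ 2 := sq_le_sq' (by linarith [abs_le.1 hr]) (abs_le.1 hr).2
  have hA3 : 3 * a ^ 2 ≤ A := by nlinarith
  have hB2 : (2 * B) ^ 2 ≤ A ^ 2 := sq_le_sq' (by linarith [abs_le.1 hB]) (abs_le.1 hB).2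
  have hA2 : 3 * A ^ 2 ≤ 16 * a * d := by nlinarith [h.2.1]
  have ha1 : a = 1 := by
    by_contra hne
    have h2 : 2 ≤ a := by lia
    have : (3 * a ^ 2) ^ 2 ≤ A ^ 2 := pow_le_pow_left₀ (by positivity) hA3 2
    have h4 : 27 * a ^ 3 ≤ 48 := by
      by_contra hlt
      nlinarith
    have : 2 ^ 3 ≤ a ^ 3 := pow_le_pow_left₀ (by norm_num) h2 3
    lia
  subst ha1
  have hA4 : A ≤ 4 := by nlinarith
  have hb1 : b = 1 := by nlinarith
  subst hb1
  exact ⟨c, r, s, t, h, hr, hs, by simpa [A, B] using hB, by simpa [A, C] using hAC,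
    by simpa [A, B, C] using hm⟩

end TernaryRep

/-- A positive definite ternary form of half-discriminant `2` is `D₃`. -/
theorem TernaryRep.two_mul_eq_sum_three_squares {n a b c r s t : ℤ}
    (h : TernaryRep 2 n a b c r s t) : ∃ x y z : ℤ, 2 * n = x ^ 2 + y ^ 2 + z ^ 2 := by
  obtain ⟨c, r, s, t, ⟨-, -, -, x, y, z, hn⟩, hr, hs, hB, hAC, hm⟩ :=
    h.exists_reduced_one (by norm_num) (by norm_num)
  rw [abs_le] at hr hs hB
  obtain ⟨hr1, hr2⟩ := hr
  obtain ⟨hs1, hs2⟩ := hs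
  have hr : r = -1 ∨ r = 0 ∨ r = 1 := by lia
  have hs : s = -1 ∨ s = 0 ∨ s = 1 := by lia
  have ht1 : -3 ≤ t := by rcases hr with rfl | rfl | rfl <;> rcases hs with rfl | rfl | rfl <;> lia
  have ht2 : t ≤ 3 := by rcases hr with rfl | rfl | rfl <;> rcases hs with rfl | rfl | rfl <;> lia
  have key : c = 1 ∧ ((r = 1 ∧ s = 1 ∧ (t = 0 ∨ t = 1)) ∨ (r = 1 ∧ s = -1 ∧ (t = 0 ∨ t = -1)) ∨
      (r = -1 ∧ s = 1 ∧ (t = 0 ∨ t = -1)) ∨ (r = -1 ∧ s = -1 ∧ (t = 0 ∨ t = 1))) := by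
    rcases hr with rfl | rfl | rfl <;> rcases hs with rfl | rfl | rfl <;> interval_cases t <;> lia
  obtain ⟨rfl, key⟩ := key
  rcases key with ⟨rfl, rfl, rfl | rfl⟩ | ⟨rfl, rfl, rfl | rfl⟩ | ⟨rfl, rfl, rfl | rfl⟩ |
    ⟨rfl, rfl, rfl | rfl⟩
  · exact ⟨x + y + z, x, y - z, by rw [hn]; ring⟩
  · exact ⟨x + y, x + z, y + z, by rw [hn]; ring⟩
  · exact ⟨x + y - z, x, y + z, by rw [hn]; ring⟩
  · exact ⟨x + y, x - z, y - z, by rw [hn]; ring⟩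
  · exact ⟨x - y + z, x, y + z, by rw [hn]; ring⟩
  · exact ⟨x - y, x + z, y - z, by rw [hn]; ring⟩
  · exact ⟨x - y - z, x, y - z, by rw [hn]; ring⟩
  · exact ⟨x - y, x - z, y + z, by rw [hn]; ring⟩

/-- A positive definite ternary form of half-discriminant `3` is `x² + (y² + y z + z²)`. -/
theorem TernaryRep.eq_sq_add_eisenstein {n a b c r s t : ℤ}
    (h : TernaryRep 3 n a b c r s t) :
    ∃ x y z : ℤ, n = x ^ 2 + (y ^ 2 + y * z + z ^ 2) := by
  obtain ⟨c, r, s, t, ⟨-, -, -, x, y, z, hn⟩, hr, hs, hB, hAC, hm⟩ :=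
    h.exists_reduced_one (by norm_num) (by norm_num)
  rw [abs_le] at hr hs hB
  obtain ⟨hr1, hr2⟩ := hr
  obtain ⟨hs1, hs2⟩ := hs
  have hr : r = -1 ∨ r = 0 ∨ r = 1 := by lia
  have hs : s = -1 ∨ s = 0 ∨ s = 1 := by lia
  have ht1 : -3 ≤ t := by rcases hr with rfl | rfl | rfl <;> rcases hs with rfl | rfl | rfl <;> lia
  have ht2 : t ≤ 3 := by rcases hr with rfl | rfl | rfl <;> rcases hs with rfl | rfl | rfl <;> lia
  have key : c = 1 ∧ s = 0 ∧ ((r = 1 ∧ t = 0) ∨ (r = -1 ∧ t = 0) ∨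
      (r = 0 ∧ t = 1) ∨ (r = 0 ∧ t = -1)) := by
    rcases hr with rfl | rfl | rfl <;> rcases hs with rfl | rfl | rfl <;> interval_cases t <;> lia
  obtain ⟨rfl, rfl, key⟩ := key
  rcases key with ⟨rfl, rfl⟩ | ⟨rfl, rfl⟩ | ⟨rfl, rfl⟩ | ⟨rfl, rfl⟩
  · exact ⟨z, x, y, by rw [hn]; ring⟩
  · exact ⟨z, x, -y, by rw [hn]; ring⟩
  · exact ⟨x, y, z, by rw [hn]; ring⟩
  · exact ⟨x, y, -z, by rw [hn]; ring⟩

/-! ### Ternary representations from Dirichlet's theorem and reciprocity -/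

open NumberTheorySymbols in
lemma exists_dvd_sq_add_of_jacobiSym {p : ℕ} (hp : p.Prime) {D : ℤ} (h : J(-D | p) = 1) :
    ∃ r : ℤ, (p : ℤ) ∣ r ^ 2 + D := by
  have := Fact.mk hp
  obtain ⟨y, hy⟩ := ZMod.isSquare_of_jacobiSym_eq_one h
  obtain ⟨r, rfl⟩ := ZMod.intCast_surjective y
  refine ⟨r, (ZMod.intCast_zmod_eq_zero_iff_dvd _ _).1 ?_⟩
  push_cast at hy ⊢
  rw [pow_two, ← hy]
  ring

open NumberTheorySymbols in
lemma jacobiSym_neg_of_mod_four_eq_three {D b : ℕ} (hD : D % 4 = 3) (hb : Odd b) :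
    J(-(D : ℤ) | b) = J(b | D) := by
  rw [jacobiSym.neg _ hb]
  rcases Nat.odd_mod_four_iff.1 (Nat.odd_iff.1 hb) with h | h
  · rw [ZMod.χ₄_nat_one_mod_four h, one_mul,
      jacobiSym.quadratic_reciprocity_one_mod_four' (Nat.odd_iff.2 (by lia)) h]
  · rw [ZMod.χ₄_nat_three_mod_four h, jacobiSym.quadratic_reciprocity_three_mod_four hD h]
    ring

open NumberTheorySymbols in
lemma jacobiSym_neg_three {D : ℕ} (hD : D % 6 = 1) : J(-3 | D) = 1 := by
  have hodd : Odd D := Nat.odd_iff.2 (by lia)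
  have h := jacobiSym_neg_of_mod_four_eq_three (D := 3) (by norm_num) hodd
  rw [jacobiSym.mod_left (D : ℤ) 3, show (D : ℤ) % (3 : ℕ) = 1 by lia, jacobiSym.one_left] at h
  exact_mod_cast h

lemma exists_prime_eq_mul_add {m a : ℕ} (hm : m ≠ 0) (h : a.Coprime m) :
    ∃ t : ℕ, (m * t + a).Prime := by
  obtain ⟨p, hpa, hp, hmod⟩ := Nat.forall_exists_prime_gt_and_modEq a hm h
  obtain ⟨t, ht⟩ := (Nat.modEq_iff_dvd' hpa.le).1 hmod.symm
  exact ⟨t, by rwa [← ht, Nat.sub_add_cancel hpa.le]⟩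

open NumberTheorySymbols in
/-- Twice an odd number is a sum of three squares. -/
theorem two_mul_odd_eq_sum_three_squares {N : ℕ} (hN : Odd N) :
    ∃ x y z : ℤ, 2 * (N : ℤ) = x ^ 2 + y ^ 2 + z ^ 2 := by
  have hN0 : 0 < N := hN.pos
  -- With `4ab = r² + D`, the form `ax² + by² + Nz² + rxy + xz` takes the value `N` and has
  -- half-discriminant `ND - b`. So `b = ND - 2` is sought prime, with `D ≡ 3 (mod 8)` so that `-D`
  -- is a square mod `b`: `J(-D | b) = J(b | D) = J(-2 | D) = 1`.
  have hcop : (3 * N - 2).Coprime (8 * N) := by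
    have h2 : Nat.Coprime (3 * N - 2) 2 := by
      rw [Nat.coprime_two_right]
      obtain ⟨k, rfl⟩ := hN
      exact ⟨3 * k, by lia⟩
    have hNc : Nat.Coprime (3 * N - 2) N := by
      have h1 : (3 * N - 2).gcd N ∣ 2 := by
        have h3 : (3 * N - 2).gcd N ∣ 3 * N := (Nat.gcd_dvd_right _ _).mul_left 3
        have h4 := Nat.dvd_sub h3 (Nat.gcd_dvd_left (3 * N - 2) N)
        rwa [show 3 * N - (3 * N - 2) = 2 by lia] at h4
      have h5 := Nat.dvd_gcd (Nat.gcd_dvd_left (3 * N - 2) N) h1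
      rw [h2] at h5
      exact Nat.dvd_one.1 h5
    exact Nat.Coprime.mul_right (Nat.Coprime.pow_right 3 h2 : Nat.Coprime _ (2 ^ 3)) hNc
  obtain ⟨k, hb⟩ := exists_prime_eq_mul_add (by lia) hcop
  set b := 8 * N * k + (3 * N - 2)
  set D := 8 * k + 3 with hD
  have hbD : b + 2 = N * D := by
    have : 2 ≤ 3 * N := by lia
    zify [b, this]; rw [hD]; push_cast; ring
  have hbodd : Odd b := by
    obtain ⟨m, hm⟩ := hN
    exact ⟨4 * N * k + 3 * m, by simp only [b]; lia⟩
  have hJ : J(-(D : ℤ) | b) = 1 := by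
    rw [jacobiSym_neg_of_mod_four_eq_three (by lia) hbodd,
      jacobiSym.mod_left' (a₂ := -2), jacobiSym.at_neg_two (Nat.odd_iff.2 (by lia)),
      ZMod.χ₈'_nat_eq_if_mod_eight]
    · have : D % 8 = 3 := by lia
      simp [this, show D % 2 = 1 by lia]
    · refine Int.ModEq.symm ((Int.modEq_iff_dvd).2 ⟨N, ?_⟩)
      have : (b : ℤ) + 2 = N * D := by exact_mod_cast hbD
      linarith
  obtain ⟨r0, hr0⟩ := exists_dvd_sq_add_of_jacobiSym hb hJ
  -- Odd `r` makes `4 ∣ r² + D`; adding the odd `b` corrects the parity.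
  obtain ⟨r, hrodd, hr⟩ : ∃ r : ℤ, Odd r ∧ (b : ℤ) ∣ r ^ 2 + D := by
    rcases Int.even_or_odd r0 with h | h
    · refine ⟨r0 + b, h.add_odd (by exact_mod_cast hbodd), ?_⟩
      rw [show (r0 + b) ^ 2 + (D : ℤ) = r0 ^ 2 + D + b * (2 * r0 + b) by ring]
      exact hr0.add (Dvd.intro _ rfl)
    · exact ⟨r0, h, hr0⟩
  have h4 : (4 : ℤ) ∣ r ^ 2 + D := by
    obtain ⟨m, rfl⟩ := hrodd
    exact ⟨m ^ 2 + m + 2 * k + 1, by rw [hD]; push_cast; ring⟩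
  have hco : IsCoprime (4 : ℤ) b := by
    have : Nat.Coprime (2 ^ 2) b := Nat.Coprime.pow_left 2 (Nat.coprime_two_left.2 hbodd)
    exact_mod_cast Nat.isCoprime_iff_coprime.2 this
  obtain ⟨a, ha⟩ := hco.mul_dvd h4 hr
  have hb0 : (0 : ℤ) < b := by exact_mod_cast hb.pos
  have hD0 : (0 : ℤ) < D := by lia
  have ha0 : 0 < a := by
    by_contra hneg
    nlinarith [sq_nonneg r]
  have hbD' : (b : ℤ) + 2 = N * D := by exact_mod_cast hbD
  refine TernaryRep.two_mul_eq_sum_three_squares (n := N) (a := a) (b := b) (c := N) (r := r)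
    (s := 1) (t := 0) ⟨ha0, by linarith, ?_, 0, 0, 1, by ring⟩
  linear_combination -(N : ℤ) * ha - hbD'

/-- Every odd natural number is of the form `u² + 2 z² + 4 w²`. -/
theorem odd_eq_sq_add_two_sq_add_four_sq {N : ℕ} (hN : Odd N) :
    ∃ u z w : ℤ, (N : ℤ) = u ^ 2 + 2 * z ^ 2 + 4 * w ^ 2 := by
  have key : ∀ a b c : ℤ, Odd a → Odd b → 2 * (N : ℤ) = a ^ 2 + b ^ 2 + c ^ 2 →
      ∃ u z w : ℤ, (N : ℤ) = u ^ 2 + 2 * z ^ 2 + 4 * w ^ 2 := by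
    rintro a b c ha hb h
    obtain ⟨k, hk⟩ := hb.add_odd ha
    obtain ⟨z, rfl⟩ : Even c := by
      have : Even (c ^ 2) := by
        rw [show c ^ 2 = 2 * N - a ^ 2 - b ^ 2 by linarith]
        exact ((even_two_mul _).sub_odd ha.pow).sub_odd hb.pow
      exact (Int.even_pow.1 this).1
    obtain rfl : a = 2 * k - b := by lia
    -- As `b` is odd, exactly one of `k` and `k - b` is even; its square supplies `4w²`.
    have h1 : (N : ℤ) = k ^ 2 + (k - b) ^ 2 + 2 * z ^ 2 := by linarith
    rcases Int.even_or_odd k with ⟨w, hw⟩ | hko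
    · exact ⟨k - b, z, w, by rw [h1, hw]; ring⟩
    · obtain ⟨w, hw⟩ := hko.sub_odd hb
      exact ⟨k, z, w, by rw [h1, hw]; ring⟩
  obtain ⟨x, y, z, h⟩ := two_mul_odd_eq_sum_three_squares hN
  -- Since `2N ≡ 2 (mod 4)`, exactly two of the three squares are odd.
  have hx : ∀ x : ℤ, (Even x ∧ x ^ 2 % 4 = 0) ∨ (Odd x ∧ x ^ 2 % 4 = 1) := fun x ↦ by
    rcases Int.even_or_odd x with hx | hx
    · obtain ⟨m, rfl⟩ := id hx
      exact .inl ⟨hx, by ring_nf; lia⟩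
    · obtain ⟨m, rfl⟩ := id hx
      exact .inr ⟨hx, by ring_nf; lia⟩
  obtain ⟨m, hm⟩ := hN
  rcases hx x with ⟨h1, h1'⟩ | ⟨h1, h1'⟩ <;> rcases hx y with ⟨h2, h2'⟩ | ⟨h2, h2'⟩ <;>
    rcases hx z with ⟨h3, h3'⟩ | ⟨h3, h3'⟩
  · lia
  · lia
  · lia
  · exact key y z x h2 h3 (by rw [h]; ring)
  · lia
  · exact key x z y h1 h3 (by rw [h]; ring)
  · exact key x y z h1 h2 h
  · lia

-- With `b² + D = qc`, the form `cx² + qy² + 3Nz² + 2bxy + 3xz` has half-discriminant `3(4ND - 3q)`,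
-- so `3q + 1 = 4ND` is wanted. Then `-3q ≡ 1 (mod D)`, and `D ≡ 1 (mod 6)` gives `J(-3 | D) = 1`,
-- hence `J(q | D) = 1`.
open NumberTheorySymbols in
lemma exists_three_mul_eq_sq_add_eisenstein {N : ℕ} (hN : N % 3 = 1) :
    ∃ x y z : ℤ, 3 * (N : ℤ) = x ^ 2 + (y ^ 2 + y * z + z ^ 2) := by
  obtain ⟨j, hj⟩ : ∃ j, 4 * N = 3 * j + 1 := ⟨(4 * N - 1) / 3, by lia⟩
  have hcop : j.Coprime (8 * N) := by
    have h1 : j.Coprime (4 * N) := by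
      rw [hj]
      simp
    have h2 : j.Coprime 2 := (Nat.Coprime.coprime_mul_right_right h1).coprime_dvd_right ⟨2, rfl⟩
    rw [show 8 * N = 2 * (4 * N) by ring]
    exact h2.mul_right h1
  obtain ⟨k, hq⟩ := exists_prime_eq_mul_add (by lia) hcop
  set q := 8 * N * k + j
  set D := 6 * k + 1 with hD
  have hqD : 3 * q + 1 = 4 * N * D := by
    simp only [q, hD]
    linear_combination -hj
  have hqD' : 3 * (q : ℤ) + 1 = 4 * N * D := by exact_mod_cast hqD
  have hq4 : q % 4 = 1 := by rw [mul_assoc] at hqD; lia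
  have hDodd : Odd D := Nat.odd_iff.2 (by lia)
  have hJ : J(-(D : ℤ) | q) = 1 := by
    have h3 := jacobiSym_neg_three (D := D) (by lia)
    have h1 : J(-3 * (q : ℤ) | D) = 1 := by
      rw [jacobiSym.mod_left' (a₂ := 1), jacobiSym.one_left]
      refine Int.ModEq.symm ((Int.modEq_iff_dvd).2 ⟨-4 * N, ?_⟩)
      linarith
    rw [jacobiSym.mul_left, h3, one_mul] at h1
    rw [jacobiSym.neg _ (Nat.odd_iff.2 (by lia)), ZMod.χ₄_nat_one_mod_four hq4, one_mul,
      jacobiSym.quadratic_reciprocity_one_mod_four' hDodd hq4, h1]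
  obtain ⟨b, c, hc⟩ := exists_dvd_sq_add_of_jacobiSym hq hJ
  have hq0 : (0 : ℤ) < q := by exact_mod_cast hq.pos
  have hD0 : (0 : ℤ) < D := by lia
  have hc0 : 0 < c := by
    by_contra hneg
    nlinarith [sq_nonneg b]
  refine TernaryRep.eq_sq_add_eisenstein (n := 3 * N) (a := c) (b := q) (c := 3 * N) (r := 2 * b)
    (s := 3) (t := 0) ⟨hc0, by linarith, ?_, 0, 0, 1, by ring⟩
  linear_combination -12 * (N : ℤ) * hc - 3 * hqD'

/-- One of `m`, `k`, `m + k` is even, and the Eisenstein norm treats the three alike. -/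
lemma eisenstein_eq_sq_add_three_sq (m k : ℤ) :
    ∃ v y : ℤ, m ^ 2 + m * k + k ^ 2 = v ^ 2 + 3 * y ^ 2 := by
  rcases Int.even_or_odd k with ⟨j, rfl⟩ | hk
  · exact ⟨m + j, j, by ring⟩
  · rcases Int.even_or_odd m with ⟨j, rfl⟩ | hm
    · exact ⟨k + j, j, by ring⟩
    · obtain ⟨j, hj⟩ := hm.sub_odd hk
      obtain rfl : m = k + 2 * j := by lia
      exact ⟨j, k + j, by ring⟩

/-- Every `N ≡ 1 (mod 3)` is of the form `v² + 3 y² + 3 z²`. -/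
theorem eq_sq_add_three_sq_add_three_sq {N : ℕ} (hN : N % 3 = 1) :
    ∃ v y z : ℤ, (N : ℤ) = v ^ 2 + 3 * y ^ 2 + 3 * z ^ 2 := by
  obtain ⟨x, y, z, h⟩ := exists_three_mul_eq_sq_add_eisenstein hN
  have hsq : ∀ u : ℤ, (u % 3 = 0 ∧ u ^ 2 % 3 = 0) ∨ u ^ 2 % 3 = 1 := fun u ↦ by
    have : u % 3 = 0 ∨ u % 3 = 1 ∨ u % 3 = 2 := by lia
    rcases this with h | h | h <;> simp [pow_two, Int.mul_emod, h]
  have h1 : 3 * (N - y * z) = x ^ 2 + (y - z) ^ 2 := by linear_combination h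
  -- `-1` is not a square mod 3, so 3 divides both terms of the sum of squares.
  obtain ⟨⟨c, rfl⟩, k, hk⟩ : 3 ∣ x ∧ 3 ∣ y - z := by
    rcases hsq x with hx | hx <;> rcases hsq (y - z) with hy | hy <;> lia
  obtain rfl : y = z + 3 * k := by lia
  obtain ⟨v, w, hv⟩ := eisenstein_eq_sq_add_three_sq (z + k) k
  exact ⟨v, w, c, by linarith⟩

/-! ### Representations with prescribed `x + y` or `x + w` -/

/-- If `p` is an odd prime with `n ≤ p² < 2n` then `n = x² + y² + z² + 2w²` with `x + y = p`. -/
theorem exists_rep_add_eq {n p : ℕ} (hp : Odd p) (h1 : n ≤ p ^ 2) (h2 : p ^ 2 < 2 * n) :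
    ∃ x y z w : ℕ, n = x ^ 2 + y ^ 2 + z ^ 2 + 2 * w ^ 2 ∧ x + y = p := by
  have hN : Odd (2 * n - p ^ 2) := Nat.Even.sub_odd h2.le (even_two_mul n) hp.pow
  obtain ⟨u, z, w, h⟩ := odd_eq_sq_add_two_sq_add_four_sq hN
  rw [Nat.cast_sub h2.le] at h
  push_cast at h
  zify at h1
  have hup : |u| ≤ p := abs_le_of_sq_le_sq (by nlinarith [sq_nonneg z, sq_nonneg w]) (by lia)
  rw [abs_le] at hup
  have hu : Odd u := by
    have hu2 : Odd (u ^ 2) := by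
      rw [show u ^ 2 = 2 * (n - z ^ 2 - 2 * w ^ 2) - (p : ℤ) ^ 2 by linarith]
      exact (even_two_mul _).sub_odd (Odd.pow (by exact_mod_cast hp))
    exact Int.Odd.of_mul_left (by rwa [pow_two] at hu2)
  obtain ⟨x, hx⟩ := (show Odd (p : ℤ) by exact_mod_cast hp).add_odd hu
  obtain rfl : u = 2 * x - p := by lia
  refine ⟨x.toNat, (p - x).toNat, z.natAbs, w.natAbs, ?_, by lia⟩
  zify
  rw [Int.toNat_of_nonneg (by lia), Int.toNat_of_nonneg (by lia), sq_abs, sq_abs]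
  linarith

/-- If `3 ∤ p`, `n ≤ p²` and `2p² ≤ 3n` then `n = x² + y² + z² + 2w²` with `x + w = p`. -/
theorem exists_rep_add_eq' {n p : ℕ} (hp : ¬ 3 ∣ p) (h1 : n ≤ p ^ 2) (h2 : 2 * p ^ 2 ≤ 3 * n) :
    ∃ x y z w : ℕ, n = x ^ 2 + y ^ 2 + z ^ 2 + 2 * w ^ 2 ∧ x + w = p := by
  have hp3 : p ^ 2 % 3 = 1 := by
    have : p % 3 = 1 ∨ p % 3 = 2 := by lia
    rcases this with h | h <;> simp [pow_two, Nat.mul_mod, h]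
  obtain ⟨v, y, z, h⟩ := eq_sq_add_three_sq_add_three_sq (N := 3 * n - 2 * p ^ 2) (by lia)
  rw [Nat.cast_sub h2] at h
  push_cast at h
  zify at h1
  have key : ∀ v : ℤ, 3 * (n : ℤ) - 2 * p ^ 2 = v ^ 2 + 3 * y ^ 2 + 3 * z ^ 2 → 3 ∣ v + p →
      ∃ x y z w : ℕ, n = x ^ 2 + y ^ 2 + z ^ 2 + 2 * w ^ 2 ∧ x + w = p := by
    rintro v h ⟨w, hw⟩
    have hvp : |v| ≤ p := abs_le_of_sq_le_sq (by nlinarith [sq_nonneg y, sq_nonneg z]) (by lia)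
    rw [abs_le] at hvp
    obtain rfl : v = 3 * w - p := by lia
    refine ⟨(p - w).toNat, y.natAbs, z.natAbs, w.toNat, ?_, by lia⟩
    zify
    rw [Int.toNat_of_nonneg (by lia), Int.toNat_of_nonneg (by lia), sq_abs, sq_abs]
    linarith
  -- Since `3 ∤ v` and `3 ∤ p`, one choice of the sign of `v` gives `3 ∣ v + p`.
  have hv : v % 3 ≠ 0 := by
    intro h0
    obtain ⟨j, rfl⟩ := Int.dvd_of_emod_eq_zero h0
    zify at hp3
    have : (p : ℤ) ^ 2 = 3 * (3 * j ^ 2 + y ^ 2 + z ^ 2 - n + p ^ 2) := by linarith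
    lia
  rcases (by lia : 3 ∣ v + p ∨ 3 ∣ -v + (p : ℤ)) with h3 | h3
  · exact key v h h3
  · exact key (-v) (by rw [h]; ring) h3

/-! ### Chebyshev's bounds for `ψ` -/

-- Passing from `n` to `n + 1` adds `∑ Λ(d)` over `d ∣ n + 1`, which is `log (n + 1)`. The free
-- cutoff `M` lets several factorials share one range of summation.
open ArithmeticFunction in
lemma sum_div_mul_vonMangoldt {n M : ℕ} (h : n ≤ M) :
    ∑ m ∈ Finset.Ioc 0 M, ((n / m : ℕ) : ℝ) * vonMangoldt m = Real.log n.factorial := by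
  induction n with
  | zero => simp
  | succ n ih =>
    have h1 : ∀ m : ℕ, (((n + 1) / m : ℕ) : ℝ) * vonMangoldt m =
        ((n / m : ℕ) : ℝ) * vonMangoldt m + if m ∣ n + 1 then vonMangoldt m else 0 := fun m ↦ by
      rw [Nat.succ_div]
      split_ifs <;> push_cast <;> ring
    have h2 : (Finset.Ioc 0 M).filter (· ∣ n + 1) = (n + 1).divisors := by
      ext m
      simp only [Finset.mem_filter, Finset.mem_Ioc, Nat.mem_divisors]
      exact ⟨fun ⟨_, hm⟩ ↦ ⟨hm, by simp⟩, fun ⟨hm, _⟩ ↦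
        ⟨⟨Nat.pos_of_dvd_of_pos hm (by simp), (Nat.le_of_dvd (by simp) hm).trans h⟩, hm⟩⟩
    rw [Finset.sum_congr rfl fun m _ ↦ h1 m, Finset.sum_add_distrib, ih (by lia),
      ← Finset.sum_filter, h2, vonMangoldt_sum, Nat.factorial_succ, Nat.cast_mul,
      Real.log_mul (by positivity) (by positivity), add_comm]

/-- The logarithm of Chebyshev's quotient `n! (n/30)! / ((n/2)! (n/3)! (n/5)!)`. -/
noncomputable def chebyshevQuotient (n : ℕ) : ℝ :=
  Real.log n.factorial - Real.log (n / 2).factorial - Real.log (n / 3).factorial -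
    Real.log (n / 5).factorial + Real.log (n / 30).factorial

open ArithmeticFunction in
lemma chebyshevQuotient_eq_sum (n : ℕ) : chebyshevQuotient n =
    ∑ m ∈ Finset.Ioc 0 n, (((n / m : ℕ) : ℝ) - (n / m / 2 : ℕ) - (n / m / 3 : ℕ) -
      (n / m / 5 : ℕ) + (n / m / 30 : ℕ)) * vonMangoldt m := by
  simp only [chebyshevQuotient, add_mul, sub_mul, Finset.sum_add_distrib, Finset.sum_sub_distrib]
  simp only [fun m ↦ Nat.div_right_comm n m 2, fun m ↦ Nat.div_right_comm n m 3,
    fun m ↦ Nat.div_right_comm n m 5, fun m ↦ Nat.div_right_comm n m 30]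
  rw [sum_div_mul_vonMangoldt le_rfl, sum_div_mul_vonMangoldt (Nat.div_le_self _ _),
    sum_div_mul_vonMangoldt (Nat.div_le_self _ _), sum_div_mul_vonMangoldt (Nat.div_le_self _ _),
    sum_div_mul_vonMangoldt (Nat.div_le_self _ _)]

open ArithmeticFunction in
lemma psi_natCast (n : ℕ) : Chebyshev.psi n = ∑ m ∈ Finset.Ioc 0 n, vonMangoldt m := by
  simp [Chebyshev.psi]

lemma chebyshevQuotient_le_psi (n : ℕ) : chebyshevQuotient n ≤ Chebyshev.psi n := by
  rw [chebyshevQuotient_eq_sum, psi_natCast]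
  refine Finset.sum_le_sum fun m _ ↦ mul_le_of_le_one_left ArithmeticFunction.vonMangoldt_nonneg ?_
  have : n / m + n / m / 30 ≤ 1 + n / m / 2 + n / m / 3 + n / m / 5 := by lia
  have : ((n / m : ℕ) : ℝ) + (n / m / 30 : ℕ) ≤
    1 + (n / m / 2 : ℕ) + (n / m / 3 : ℕ) + (n / m / 5 : ℕ) := by exact_mod_cast this
  linarith

/-- The coefficient of `Λ(m)` is never negative, and it is 1 when `⌊n/m⌋` is between 1 and 5. -/
lemma psi_sub_psi_le_chebyshevQuotient (n : ℕ) :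
    Chebyshev.psi n - Chebyshev.psi (n / 6 : ℕ) ≤ chebyshevQuotient n := by
  rw [chebyshevQuotient_eq_sum, psi_natCast, psi_natCast,
    ← Finset.sum_Ioc_consecutive _ (Nat.zero_le _) (Nat.div_le_self n 6), add_sub_cancel_left,
    ← Finset.sum_Ioc_consecutive _ (Nat.zero_le _) (Nat.div_le_self n 6)]
  have key : ∀ m, (if n / 6 < m ∧ m ≤ n then (1 : ℝ) else 0) ≤ ((n / m : ℕ) : ℝ) - (n / m / 2 : ℕ) -
      (n / m / 3 : ℕ) - (n / m / 5 : ℕ) + (n / m / 30 : ℕ) := fun m ↦ by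
    have h : (if n / 6 < m ∧ m ≤ n then 1 else 0) + n / m / 2 + n / m / 3 + n / m / 5 ≤
        n / m + n / m / 30 := by
      split_ifs with h
      · have h1 : n / m < 6 := by
          rw [Nat.div_lt_iff_lt_mul (by lia)]; lia
        have h2 : 1 ≤ n / m := (Nat.one_le_div_iff (by lia)).2 h.2
        lia
      · lia
    have : (if n / 6 < m ∧ m ≤ n then (1 : ℝ) else 0) + (n / m / 2 : ℕ) + (n / m / 3 : ℕ) +
        (n / m / 5 : ℕ) ≤ (n / m : ℕ) + (n / m / 30 : ℕ) := by exact_mod_cast h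
    linarith
  refine le_add_of_nonneg_of_le (Finset.sum_nonneg fun m _ ↦ mul_nonneg
    (le_trans (by split_ifs <;> norm_num) (key m)) ArithmeticFunction.vonMangoldt_nonneg)
    (Finset.sum_le_sum fun m hm ↦ ?_)
  rw [Finset.mem_Ioc] at hm
  have := key m
  rw [if_pos hm] at this
  exact le_mul_of_one_le_left ArithmeticFunction.vonMangoldt_nonneg this

/-- The convex function `b log b - b` lies above its tangent line at `a`. -/
lemma Real.mul_log_sub_self_ge {a b : ℝ} (ha : 0 < a) (hb : 0 < b) :
    a * log a - a + (b - a) * log a ≤ b * log b - b := by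
  have h := Real.log_le_sub_one_of_pos (div_pos ha hb)
  rw [Real.log_div ha.ne' hb.ne'] at h
  have := mul_le_mul_of_nonneg_left h hb.le
  rw [mul_sub, mul_sub, mul_div_cancel₀ _ hb.ne'] at this
  linarith

lemma log_factorial_le {n : ℕ} (hn : n ≠ 0) :
    Real.log n.factorial ≤ n * Real.log n - n + 1 + Real.log n := by
  induction n with
  | zero => contradiction
  | succ n ih =>
    rcases eq_or_ne n 0 with rfl | hn
    · simp
    have h := Real.mul_log_sub_self_ge (a := n) (b := n + 1) (by positivity) (by positivity)
    have := ih hn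
    rw [Nat.factorial_succ, Nat.cast_mul, Real.log_mul (by positivity) (by positivity)]
    push_cast
    linarith

lemma le_log_factorial (n : ℕ) : n * Real.log n - n ≤ Real.log n.factorial := by
  rcases eq_or_ne n 0 with rfl | hn
  · simp
  have := Stirling.le_log_factorial_stirling hn
  have h1 : 0 ≤ Real.log n := Real.log_natCast_nonneg n
  have h2 : 0 ≤ Real.log (2 * Real.pi) := Real.log_nonneg (by linarith [Real.pi_gt_three])
  linarith

lemma log_factorial_div_bounds {n k : ℕ} (hk : 0 < k) (hkn : k ≤ n) :
    (n / k : ℝ) * (Real.log n - Real.log k) - n / k - Real.log n ≤ Real.log (n / k).factorial ∧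
      Real.log (n / k).factorial ≤
        (n / k : ℝ) * (Real.log n - Real.log k) - n / k + 1 + Real.log n := by
  have hm1 : 1 ≤ n / k := (Nat.one_le_div_iff hk).2 hkn
  have hm : (1 : ℝ) ≤ (n / k : ℕ) := by exact_mod_cast hm1
  have hmx : ((n / k : ℕ) : ℝ) ≤ n / k := Nat.cast_div_le
  have hmx' : (n / k : ℝ) < (n / k : ℕ) + 1 := by
    rw [div_lt_iff₀ (by exact_mod_cast hk)]
    exact_mod_cast Nat.lt_mul_of_div_lt (Nat.lt_succ_self _) hk
  have hx1 : (1 : ℝ) ≤ n / k := hm.trans hmx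
  have hn : (n : ℝ) ≠ 0 := by
    have : 0 < n := by lia
    positivity
  rw [← Real.log_div hn (by positivity)]
  have hxn : Real.log (n / k) ≤ Real.log n :=
    Real.log_le_log (by linarith) (div_le_self (by positivity) (by exact_mod_cast hk))
  have hlogm : Real.log (n / k : ℕ) ≤ Real.log (n / k) := Real.log_le_log (by linarith) hmx
  have h0 : 0 ≤ Real.log (n / k : ℕ) := Real.log_nonneg hm
  have hlo := le_log_factorial (n / k)
  have hup := log_factorial_le (n := n / k) (by lia)
  constructor
  · have := Real.mul_log_sub_self_ge (a := n / k) (b := (n / k : ℕ)) (by linarith) (by linarith)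
    nlinarith
  · have := Real.mul_log_sub_self_ge (a := (n / k : ℕ)) (b := n / k) (by linarith) (by linarith)
    nlinarith

/-- The constant in Chebyshev's bounds, about `0.92129`. -/
noncomputable def chebyshevConst : ℝ := (14 * Real.log 2 + 9 * Real.log 3 + 5 * Real.log 5) / 30

/-- Because `1 - 1/2 - 1/3 - 1/5 + 1/30 = 0`, the `n log n` and `n` terms of Stirling's formula
cancel; only the `log k / k` terms remain at order `n`. -/
lemma abs_chebyshevQuotient_sub_le {n : ℕ} (hn : 30 ≤ n) :
    |chebyshevQuotient n - chebyshevConst * n| ≤ 5 * Real.log n + 3 := by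
  have h1 := log_factorial_div_bounds (n := n) (k := 1) (by lia) (by lia)
  have h2 := log_factorial_div_bounds (n := n) (k := 2) (by lia) (by lia)
  have h3 := log_factorial_div_bounds (n := n) (k := 3) (by lia) (by lia)
  have h5 := log_factorial_div_bounds (n := n) (k := 5) (by lia) (by lia)
  have h30 := log_factorial_div_bounds (n := n) (k := 30) (by lia) (by lia)
  have hlog : Real.log 30 = Real.log 2 + Real.log 3 + Real.log 5 := by
    rw [← Real.log_mul, ← Real.log_mul] <;> norm_num
  simp only [Nat.div_one, Nat.cast_one, Real.log_one, div_one, Nat.cast_ofNat,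
    hlog] at h1 h2 h3 h5 h30
  rw [abs_le, chebyshevQuotient, chebyshevConst]
  constructor
  · linarith [h1.1, h2.2, h3.2, h5.2, h30.1]
  · linarith [h1.2, h2.1, h3.1, h5.1, h30.2]

lemma psi_ge_chebyshev {n : ℕ} (hn : 30 ≤ n) :
    chebyshevConst * n - (5 * Real.log n + 3) ≤ Chebyshev.psi n := by
  linarith [(abs_le.1 (abs_chebyshevQuotient_sub_le hn)).1, chebyshevQuotient_le_psi n]

lemma psi_le_psi_add_chebyshev {n : ℕ} (hn : 30 ≤ n) :
    Chebyshev.psi n ≤ Chebyshev.psi (n / 6 : ℕ) + (chebyshevConst * n + (5 * Real.log n + 3)) := by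
  linarith [(abs_le.1 (abs_chebyshevQuotient_sub_le hn)).2, psi_sub_psi_le_chebyshevQuotient n]

lemma chebyshevConst_ge : 0.866 ≤ chebyshevConst := by
  have h2 := Real.log_two_gt_d9
  have h3 : 3 * Real.log 2 ≤ 2 * Real.log 3 := by
    have : Real.log (2 ^ 3) ≤ Real.log (3 ^ 2) := Real.log_le_log (by norm_num) (by norm_num)
    simpa using this
  have h5 : 2 * Real.log 2 ≤ Real.log 5 := by
    have : Real.log (2 ^ 2) ≤ Real.log 5 := Real.log_le_log (by norm_num) (by norm_num)
    simpa using this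
  rw [chebyshevConst]
  linarith

/-- Four steps `n → n/6` give `259/216 = 1 + 1/6 + 1/36 + 1/216`, and a crude bound on `ψ(n/1296)`
gives `0.0042`. The hypothesis `6480 = 30·216` keeps the fourth step legal. -/
lemma psi_le_chebyshev {n : ℕ} (hn : 6480 ≤ n) :
    Chebyshev.psi n ≤ (chebyshevConst * (259 / 216) + 0.0042) * n + 20 * Real.log n + 12 := by
  have hC := chebyshevConst_ge
  have step : ∀ k m : ℕ, 0 < k → n / k = m → 30 ≤ m → Chebyshev.psi m ≤
      Chebyshev.psi (n / (k * 6) : ℕ) +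
        (chebyshevConst * (n / k : ℝ) + (5 * Real.log n + 3)) := by
    rintro k m hk rfl hm
    have h := psi_le_psi_add_chebyshev hm
    rw [Nat.div_div_eq_div_mul] at h
    have h1 : ((n / k : ℕ) : ℝ) ≤ n / k := Nat.cast_div_le
    have h2 : Real.log (n / k : ℕ) ≤ Real.log n :=
      Real.log_le_log (by exact_mod_cast (by lia : 0 < n / k))
        (by exact_mod_cast Nat.div_le_self n k)
    nlinarith
  have h1 := step 1 n (by lia) (by simp) (by lia)
  have h2 := step 6 _ (by lia) rfl (by lia)
  have h3 := step 36 _ (by lia) rfl (by lia)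
  have h4 := step 216 _ (by lia) rfl (by lia)
  have h5 : Chebyshev.psi (n / 1296 : ℕ) ≤ 0.0042 * n := by
    have hlog4 : Real.log 4 ≤ 1.4 := by
      rw [show (4 : ℝ) = 2 ^ 2 by norm_num, Real.log_pow]
      push_cast
      linarith [Real.log_two_lt_d9]
    have h6 : ((n / 1296 : ℕ) : ℝ) ≤ n / (1296 : ℕ) := Nat.cast_div_le
    have h7 := Chebyshev.psi_le_const_mul_self (x := (n / 1296 : ℕ)) (by positivity)
    push_cast at h6
    have h8 : (0 : ℝ) ≤ (n / 1296 : ℕ) := by positivity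
    nlinarith
  norm_num at h1 h2 h3 h4 h5 ⊢
  linarith

/-! ### Primes in `(N, 11N/9]` -/

lemma exists_prime_of_theta_lt {N M : ℕ} (h : Chebyshev.theta N < Chebyshev.theta M) :
    ∃ p, p.Prime ∧ N < p ∧ p ≤ M := by
  by_contra! hno
  refine h.not_ge ?_
  simp only [Chebyshev.theta, Nat.floor_natCast]
  refine Finset.sum_le_sum_of_subset_of_nonneg (fun p hp ↦ ?_)
    fun p hp _ ↦ Real.log_natCast_nonneg p
  simp only [Finset.mem_filter, Finset.mem_Ioc] at hp ⊢
  have : p ≤ N := by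
    by_contra! hlt
    exact absurd (hno p hp.2 hlt) (by lia)
  exact ⟨⟨hp.1.1, this⟩, hp.2⟩

/-- The main terms leave room since `11/9 > 259/216`; from `2 ^ 24` on, this margin absorbs the
logarithms and `ψ - θ`. -/
lemma exists_prime_of_large {N : ℕ} (hN : 2 ^ 24 ≤ N) : ∃ p, p.Prime ∧ N < p ∧ 9 * p ≤ 11 * N := by
  set M := 11 * N / 9 with hM
  suffices h : Chebyshev.theta N < Chebyshev.theta M by
    obtain ⟨p, hp, h1, h2⟩ := exists_prime_of_theta_lt h
    exact ⟨p, hp, h1, by lia⟩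
  have hNM : N ≤ M := by lia
  have hM9 : (11 : ℝ) * N ≤ 9 * M + 8 := by exact_mod_cast (by lia : 11 * N ≤ 9 * M + 8)
  have hM24 : (2 : ℝ) ^ 24 ≤ M := by exact_mod_cast hN.trans hNM
  obtain ⟨s, hs⟩ : ∃ s, √(M : ℝ) = s := ⟨_, rfl⟩
  have hsM : (M : ℝ) = s ^ 2 := by rw [← hs, Real.sq_sqrt (by positivity)]
  have hs12 : 4096 ≤ s := by
    rw [← hs]
    exact Real.le_sqrt_of_sq_le (by norm_num at hM24 ⊢; exact hM24)
  -- Tangent line of `log` at `4096 = 2 ^ 12`; `12 log 2 - 1 < 7.318`.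
  have hL : Real.log s ≤ 7.318 + s / 4096 := by
    have h1 := Real.log_le_sub_one_of_pos (show 0 < s / 2 ^ 12 by positivity)
    rw [Real.log_div (by positivity) (by positivity), Real.log_pow] at h1
    have h2 := Real.log_two_lt_d9
    norm_num at h1 ⊢
    linarith
  have hlogM : Real.log M = 2 * Real.log s := by rw [hsM, Real.log_pow]; norm_num
  have hlogN : Real.log N ≤ Real.log M :=
    Real.log_le_log (by exact_mod_cast (by lia : 0 < N)) (by exact_mod_cast hNM)
  have h1 := Chebyshev.psi_sub_theta_le (x := M) (by linarith)
  have h2 := psi_ge_chebyshev (n := M) (by lia)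
  have h3 := psi_le_chebyshev (n := N) (by lia)
  have h4 := Chebyshev.theta_le_psi N
  have hC := chebyshevConst_ge
  rw [hs] at h1
  rw [hlogM] at h1 h2 hlogN
  have h5 : 0.866 * ((M : ℝ) - 259 / 216 * N) ≤ chebyshevConst * (M - 259 / 216 * N) :=
    mul_le_mul_of_nonneg_right hC (by linarith)
  have h6 : s * Real.log s ≤ s * (7.318 + s / 4096) :=
    mul_le_mul_of_nonneg_left hL (by linarith)
  have h7 : 4096 * s ≤ M := by rw [hsM]; nlinarith
  have h8 : s * (7.318 + s / 4096) = 7.318 * s + M / 4096 := by rw [hsM]; ring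
  linarith

/-- Link of a chain of primes: `p` serves every `N` with `q ≤ N < p`, and larger `N` pass to the
next link. -/
lemma exists_prime_step {N q : ℕ} (p : ℕ) (hp : p.Prime) (hpq : 9 * p ≤ 11 * q) (hq : q ≤ N)
    (h : p ≤ N → ∃ p, p.Prime ∧ N < p ∧ 9 * p ≤ 11 * N) :
    ∃ p, p.Prime ∧ N < p ∧ 9 * p ≤ 11 * N := by
  rcases le_or_gt p N with hpN | hpN
  · exact h hpN
  · exact ⟨p, hp, hpN, by lia⟩

/-- A sharpening of Bertrand's postulate. -/
theorem exists_prime_lt_and_le_eleven_ninths {N : ℕ} (h : 24 ≤ N) :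
    ∃ p, p.Prime ∧ N < p ∧ 9 * p ≤ 11 * N := by
  refine exists_prime_step 29 (by norm_num) (by norm_num) h fun h ↦ ?_
  refine exists_prime_step 31 (by norm_num) (by norm_num) h fun h ↦ ?_
  refine exists_prime_step 37 (by norm_num) (by norm_num) h fun h ↦ ?_
  refine exists_prime_step 43 (by norm_num) (by norm_num) h fun h ↦ ?_
  refine exists_prime_step 47 (by norm_num) (by norm_num) h fun h ↦ ?_
  refine exists_prime_step 53 (by norm_num) (by norm_num) h fun h ↦ ?_
  refine exists_prime_step 61 (by norm_num) (by norm_num) h fun h ↦ ?_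
  refine exists_prime_step 73 (by norm_num) (by norm_num) h fun h ↦ ?_
  refine exists_prime_step 89 (by norm_num) (by norm_num) h fun h ↦ ?_
  refine exists_prime_step 107 (by norm_num) (by norm_num) h fun h ↦ ?_
  refine exists_prime_step 127 (by norm_num) (by norm_num) h fun h ↦ ?_
  refine exists_prime_step 151 (by norm_num) (by norm_num) h fun h ↦ ?_
  refine exists_prime_step 181 (by norm_num) (by norm_num) h fun h ↦ ?_
  refine exists_prime_step 211 (by norm_num) (by norm_num) h fun h ↦ ?_
  refine exists_prime_step 257 (by norm_num) (by norm_num) h fun h ↦ ?_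
  refine exists_prime_step 313 (by norm_num) (by norm_num) h fun h ↦ ?_
  refine exists_prime_step 379 (by norm_num) (by norm_num) h fun h ↦ ?_
  refine exists_prime_step 463 (by norm_num) (by norm_num) h fun h ↦ ?_
  refine exists_prime_step 563 (by norm_num) (by norm_num) h fun h ↦ ?_
  refine exists_prime_step 683 (by norm_num) (by norm_num) h fun h ↦ ?_
  refine exists_prime_step 829 (by norm_num) (by norm_num) h fun h ↦ ?_
  refine exists_prime_step 1013 (by norm_num) (by norm_num) h fun h ↦ ?_
  refine exists_prime_step 1237 (by norm_num) (by norm_num) h fun h ↦ ?_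
  refine exists_prime_step 1511 (by norm_num) (by norm_num) h fun h ↦ ?_
  refine exists_prime_step 1831 (by norm_num) (by norm_num) h fun h ↦ ?_
  refine exists_prime_step 2237 (by norm_num) (by norm_num) h fun h ↦ ?_
  refine exists_prime_step 2731 (by norm_num) (by norm_num) h fun h ↦ ?_
  refine exists_prime_step 3331 (by norm_num) (by norm_num) h fun h ↦ ?_
  refine exists_prime_step 4057 (by norm_num) (by norm_num) h fun h ↦ ?_
  refine exists_prime_step 4957 (by norm_num) (by norm_num) h fun h ↦ ?_
  refine exists_prime_step 6053 (by norm_num) (by norm_num) h fun h ↦ ?_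
  refine exists_prime_step 7393 (by norm_num) (by norm_num) h fun h ↦ ?_
  refine exists_prime_step 9029 (by norm_num) (by norm_num) h fun h ↦ ?_
  refine exists_prime_step 11027 (by norm_num) (by norm_num) h fun h ↦ ?_
  refine exists_prime_step 13477 (by norm_num) (by norm_num) h fun h ↦ ?_
  refine exists_prime_step 16453 (by norm_num) (by norm_num) h fun h ↦ ?_
  refine exists_prime_step 20107 (by norm_num) (by norm_num) h fun h ↦ ?_
  refine exists_prime_step 24571 (by norm_num) (by norm_num) h fun h ↦ ?_
  refine exists_prime_step 30029 (by norm_num) (by norm_num) h fun h ↦ ?_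
  refine exists_prime_step 36697 (by norm_num) (by norm_num) h fun h ↦ ?_
  refine exists_prime_step 44851 (by norm_num) (by norm_num) h fun h ↦ ?_
  refine exists_prime_step 54799 (by norm_num) (by norm_num) h fun h ↦ ?_
  refine exists_prime_step 66973 (by norm_num) (by norm_num) h fun h ↦ ?_
  refine exists_prime_step 81853 (by norm_num) (by norm_num) h fun h ↦ ?_
  refine exists_prime_step 100019 (by norm_num) (by norm_num) h fun h ↦ ?_
  refine exists_prime_step 122231 (by norm_num) (by norm_num) h fun h ↦ ?_
  refine exists_prime_step 149393 (by norm_num) (by norm_num) h fun h ↦ ?_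
  refine exists_prime_step 182587 (by norm_num) (by norm_num) h fun h ↦ ?_
  refine exists_prime_step 223151 (by norm_num) (by norm_num) h fun h ↦ ?_
  refine exists_prime_step 272737 (by norm_num) (by norm_num) h fun h ↦ ?_
  refine exists_prime_step 333341 (by norm_num) (by norm_num) h fun h ↦ ?_
  refine exists_prime_step 407401 (by norm_num) (by norm_num) h fun h ↦ ?_
  refine exists_prime_step 497929 (by norm_num) (by norm_num) h fun h ↦ ?_
  refine exists_prime_step 608527 (by norm_num) (by norm_num) h fun h ↦ ?_
  refine exists_prime_step 743747 (by norm_num) (by norm_num) h fun h ↦ ?_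
  refine exists_prime_step 909023 (by norm_num) (by norm_num) h fun h ↦ ?_
  refine exists_prime_step 1111021 (by norm_num) (by norm_num) h fun h ↦ ?_
  refine exists_prime_step 1357907 (by norm_num) (by norm_num) h fun h ↦ ?_
  refine exists_prime_step 1659661 (by norm_num) (by norm_num) h fun h ↦ ?_
  refine exists_prime_step 2028461 (by norm_num) (by norm_num) h fun h ↦ ?_
  refine exists_prime_step 2479219 (by norm_num) (by norm_num) h fun h ↦ ?_
  refine exists_prime_step 3030151 (by norm_num) (by norm_num) h fun h ↦ ?_
  refine exists_prime_step 3703507 (by norm_num) (by norm_num) h fun h ↦ ?_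
  refine exists_prime_step 4526507 (by norm_num) (by norm_num) h fun h ↦ ?_
  refine exists_prime_step 5532389 (by norm_num) (by norm_num) h fun h ↦ ?_
  refine exists_prime_step 6761803 (by norm_num) (by norm_num) h fun h ↦ ?_
  refine exists_prime_step 8264423 (by norm_num) (by norm_num) h fun h ↦ ?_
  refine exists_prime_step 10100953 (by norm_num) (by norm_num) h fun h ↦ ?_
  refine exists_prime_step 12345581 (by norm_num) (by norm_num) h fun h ↦ ?_
  refine exists_prime_step 15088999 (by norm_num) (by norm_num) h fun h ↦ ?_
  refine exists_prime_step 18442097 (by norm_num) (by norm_num) h fun h ↦ ?_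
  exact exists_prime_of_large (by lia)

lemma exists_prime_sq_bounds {n : ℕ} (hn : 576 ≤ n) :
    ∃ p, p.Prime ∧ 5 ≤ p ∧ n ≤ p ^ 2 ∧ 2 * p ^ 2 ≤ 3 * n := by
  have hs : 24 ≤ n.sqrt := Nat.le_sqrt'.2 (by lia)
  obtain ⟨p, hp, h1, h2⟩ := exists_prime_lt_and_le_eleven_ninths hs
  have h3 := Nat.sqrt_le' n
  have h4 : n < p ^ 2 := (Nat.sqrt_lt' ).1 h1
  refine ⟨p, hp, by lia, h4.le, ?_⟩
  have := Nat.pow_le_pow_left h2 2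
  rw [mul_pow, mul_pow] at this
  lia

/-! ### Small cases and conclusion -/

lemma small_primes : ∀ p ∈ [2, 3, 5, 7, 11, 13, 17, 19, 23, 29], p.Prime := by
  norm_num

/-- Either a listed prime lies in the window, or `x, y, w` are searched and `z` is recovered by
testing the remainder for being a square. -/
lemma small_rep_add_prime : ∀ n < 576, 1 < n →
    (∃ p ∈ [3, 5, 7, 11, 13, 17, 19, 23, 29], n ≤ p ^ 2 ∧ p ^ 2 < 2 * n) ∨
    ∃ x < 10, ∃ y < 10, x + y ∈ [2, 3, 5, 7, 11, 13] ∧ ∃ w < 8, x ^ 2 + y ^ 2 + 2 * w ^ 2 ≤ n ∧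
      (n - (x ^ 2 + y ^ 2 + 2 * w ^ 2)).sqrt ^ 2 = n - (x ^ 2 + y ^ 2 + 2 * w ^ 2) := by
  decide +kernel

lemma small_rep_add_prime' : ∀ n < 576, 2 < n →
    (∃ p ∈ [5, 7, 11, 13, 17, 19, 23, 29], n ≤ p ^ 2 ∧ 2 * p ^ 2 ≤ 3 * n) ∨
    ∃ x < 24, ∃ w < 17, x + w ∈ [2, 3, 5, 7, 11, 13, 17, 19, 23] ∧ ∃ y < 24,
      x ^ 2 + y ^ 2 + 2 * w ^ 2 ≤ n ∧
      (n - (x ^ 2 + y ^ 2 + 2 * w ^ 2)).sqrt ^ 2 = n - (x ^ 2 + y ^ 2 + 2 * w ^ 2) := by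
  decide +kernel

theorem corollary1p3 :
    (∀ n : ℕ, 1 < n → ∃ x y z w p : ℕ, p.Prime ∧
      n = x ^ 2 + y ^ 2 + z ^ 2 + 2 * w ^ 2 ∧ x + y = p) ∧
    (∀ n : ℕ, 2 < n → ∃ x y z w : ℕ,
      n = x ^ 2 + y ^ 2 + z ^ 2 + 2 * w ^ 2 ∧ (x + w).Prime) := by
  refine ⟨fun n hn ↦ ?_, fun n hn ↦ ?_⟩
  · have of_prime : ∀ p : ℕ, p.Prime → 3 ≤ p → n ≤ p ^ 2 → p ^ 2 < 2 * n →
        ∃ x y z w p : ℕ, p.Prime ∧ n = x ^ 2 + y ^ 2 + z ^ 2 + 2 * w ^ 2 ∧ x + y = p := by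
      intro p hp h3 h1 h2
      obtain ⟨x, y, z, w, h, hxy⟩ := exists_rep_add_eq (hp.odd_of_ne_two (by lia)) h1 h2
      exact ⟨x, y, z, w, p, hp, h, hxy⟩
    rcases lt_or_ge n 576 with hlt | hge
    · rcases small_rep_add_prime n hlt hn with ⟨p, hp, h1, h2⟩ | ⟨x, -, y, -, hp, w, -, hle, hz⟩
      · exact of_prime p (small_primes p (by simp at hp ⊢; lia)) (by simp at hp; lia) h1 h2
      · exact ⟨x, y, _, w, _, small_primes (x + y) (by simp at hp ⊢; lia),
          by rw [hz]; lia, rfl⟩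
    · obtain ⟨p, hp, h5, h1, h2⟩ := exists_prime_sq_bounds hge
      exact of_prime p hp (by lia) h1 (by lia)
  · have of_prime : ∀ p : ℕ, p.Prime → 5 ≤ p → n ≤ p ^ 2 → 2 * p ^ 2 ≤ 3 * n →
        ∃ x y z w : ℕ, n = x ^ 2 + y ^ 2 + z ^ 2 + 2 * w ^ 2 ∧ (x + w).Prime := by
      intro p hp h5 h1 h2
      have h3 : ¬ 3 ∣ p := fun h ↦ by
        have := (Nat.prime_dvd_prime_iff_eq Nat.prime_three hp).1 h
        lia
      obtain ⟨x, y, z, w, h, hxw⟩ := exists_rep_add_eq' h3 h1 h2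
      exact ⟨x, y, z, w, h, hxw ▸ hp⟩
    rcases lt_or_ge n 576 with hlt | hge
    · rcases small_rep_add_prime' n hlt hn with ⟨p, hp, h1, h2⟩ | ⟨x, -, w, -, hp, y, -, hle, hz⟩
      · exact of_prime p (small_primes p (by simp at hp ⊢; lia)) (by simp at hp; lia) h1 h2
      · exact ⟨x, y, _, w, by rw [hz]; lia, small_primes (x + w) (by simp at hp ⊢; lia)⟩
    · obtain ⟨p, hp, h5, h1, h2⟩ := exists_prime_sq_bounds hge
      exact of_prime p hp h5 h1 h2
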